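/- Fix a dimension $d$, a contraction factor $\kappa\in(0,1)$, restart parameters $\tau\in(0,1)$, $\eta>0$ and a memory bound $m\in\{1,2,\dots\}$, and write $\|\cdot\|$ for the Euclidean norm on $\mathbb R^d$ and the induced operator norm. **The method.** Let $g:\mathbb R^d\to\mathbb R^d$ and let $r_k=g(x_k)-x_k$. From a starting point $x_0$, with $m_0=0$ on entry to iteration $0$, the restarted Type-II Anderson mixing method with mixing parameters $\beta_k=1$ performs, for $k=0,1,2,\dots$: 1. If $m_k>m$ or $\|r_k\|>\eta\|r_{k-m_k}\|$, set $m_k=0$. 2. If $m_k>0$: start from $p_k=x_k-x_{k-1}$, $q_k=r_k-r_{k-1}$, and for $j=1,\dots,m_k-1$, with $i=k-m_k+j$, compute $\zeta=(q_i^{\mathrm T}q_k)/(q_i^{\mathrm T}q_i)$ and replace $p_k$ by $p_k-\zeta p_i$ and $q_k$ by $q_k-\zeta q_i$. If then $|q_k^{\mathrm T}q_k|<\tau\,|q_{k-m_k+1}^{\mathrm T}q_{k-m_k+1}|$, set $m_k=0$. 3. Start from $\bar x_k=x_k$, $\bar r_k=r_k$, and for $j=1,\dots,m_k$, with $i=k-m_k+j$,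 compute $\gamma=(q_i^{\mathrm T}\bar r_k)/(q_i^{\mathrm T}q_i)$ and replace $\bar x_k$ by $\bar x_k-\gamma p_i$ and $\bar r_k$ by $\bar r_k-\gamma q_i$. Set $x_{k+1}=\bar x_k+\bar r_k$, and let $m_{k+1}=m_k+1$ on entry to iteration $k+1$. Below, $m_k$ is the final value in iteration $k$, and quotients with denominator $0$ are read as $0$ (so that the iteration is constant once an exact solution is hit). **Statement.** There is a constant $C>0$, depending only on $d,\kappa,\tau,\eta,m$, such that for all $\hat\rho,\hat\kappa>0$ there is $\delta>0$, depending only on $d,\kappa,\tau,\eta,m,\hat\rho,\hat\kappa$, with the following property. Suppose that $g(x^*)=x^*$ and that on the ball $B=\{z:\|z-x^*\|\le\hat\rho\}$ the map $g$ is differentiable with $$\|g(y)-g(x)\|\le\kappa\|y-x\|,\qquad \|g'(y)-g'(x)\|\le\hat\kappa\|y-x\|\qquad(x,y\in B).$$ Put $A=I-g'(x^*)$. If $\|x_0-x^*\|\le\delta$, then for every $k\ge 0$ $$\|r_{k+1}\|\le\kappa\min_{\substack{p\in\mathbb R[t],\ \deg p\le m_k\\ p(0)=1}}\|p(A)\,r_{k-m_k}\|+\hat\kappa\,C\,\|x_{k-m_k}-x^*\|^2,$$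 where the minimum is attained; and if $m_k=d$, then $$\|x_{k+1}-x^*\|\le\hat\kappa\,C\,\|x_{k-m_k}-x^*\|^2$$ ($(d+1)$-step quadratic convergence). -/

import Mathlib

open Polynomial

/-- `g` has the fixed point `xs`, and on the closed ball of radius `ρ` about `xs` it is a
contraction with factor `κ` and is differentiable with a `κh`-Lipschitz Jacobian
(in the operator norm). -/
structure IsLocalContraction {E : Type*} [NormedAddCommGroup E] [NormedSpace ℝ E]
    (g : E → E) (xs : E) (ρ κ κh : ℝ) : Prop where
  fixed : g xs = xs
  differentiable : ∀ x ∈ Metric.closedBall xs ρ, DifferentiableAt ℝ g x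
  contraction : ∀ x ∈ Metric.closedBall xs ρ, ∀ y ∈ Metric.closedBall xs ρ,
    ‖g y - g x‖ ≤ κ * ‖y - x‖
  jacobian_lipschitz : ∀ x ∈ Metric.closedBall xs ρ, ∀ y ∈ Metric.closedBall xs ρ,
    ‖fderiv ℝ g y - fderiv ℝ g x‖ ≤ κh * ‖y - x‖

namespace RestartedAM

/-- The residual `g x - x`. -/
def residual {E : Type*} [AddGroup E] (g : E → E) (x : E) : E := g x - x

/-- The Type-II elimination loop: for `j = 1, …, n` in this order, with `i = s + j`, replace the
pair `(u, w)` by `(u - γ p_i, w - γ q_i)`, where `γ = (q_iᵀ w) / (q_iᵀ q_i)` is computed from the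
current `w`. -/
noncomputable def sweep {E : Type*} [NormedAddCommGroup E] [InnerProductSpace ℝ E]
    (p q : ℕ → E) (s : ℕ) : ℕ → E × E → E × E
  | 0, w => w
  | n + 1, w =>
    let w' := sweep p q s n w
    let γ : ℝ := inner ℝ (q (s + n + 1)) w'.2 / inner ℝ (q (s + n + 1)) (q (s + n + 1))
    (w'.1 - γ • p (s + n + 1), w'.2 - γ • q (s + n + 1))

/-- The value of the memory counter on entry to iteration `k`, before any restart test, where
`M j` is its final value in iteration `j`. -/
def entryMem (M : ℕ → ℕ) : ℕ → ℕ
  | 0 => 0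
  | k + 1 => M k + 1

open Classical in
/-- The memory counter in iteration `k` after the tests on the memory size and on the growth
of the residual, and before the test on the new vector pair. -/
noncomputable def candMem {E : Type*} [NormedAddCommGroup E]
    (g : E → E) (m : ℕ) (η : ℝ) (x : ℕ → E) (M : ℕ → ℕ) (k : ℕ) : ℕ :=
  if m < entryMem M k ∨
      η * ‖residual g (x (k - entryMem M k))‖ < ‖residual g (x k)‖ then 0
  else entryMem M k

open Classical in
/-- `x` is the sequence of iterates of the restarted Type-II Anderson mixing method for the
fixed-point problem `x = g x`, with mixing parameters `β k`, memory bound `m` and restart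
parameters `τ`, `η`; `(p k, q k)` are the modified vector pairs and `M k` is the memory actually
used in iteration `k` (so that the last restart took place in iteration `k - M k`).
The iteration is continued after an exact solution has been hit; it is constant from then on. -/
structure IsRun {E : Type*} [NormedAddCommGroup E] [InnerProductSpace ℝ E]
    (g : E → E) (β : ℕ → ℝ) (m : ℕ) (τ η : ℝ)
    (x p q : ℕ → E) (M : ℕ → ℕ) : Prop where
  /-- the new pair: the differences of the last two iterates and residuals, after elimination of
  the earlier pairs of the current cycle -/
  pair : ∀ k, 0 < candMem g m η x M k →
    (p k, q k) = sweep p q (k - candMem g m η x M k) (candMem g m η x M k - 1)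
      (x k - x (k - 1), residual g (x k) - residual g (x (k - 1)))
  /-- the test on the new pair against the first pair of the current cycle -/
  memory : ∀ k, M k =
    if 0 < candMem g m η x M k ∧
        |(inner ℝ (q k) (q k) : ℝ)| <
          τ * |(inner ℝ (q (k - candMem g m η x M k + 1))
                (q (k - candMem g m η x M k + 1)) : ℝ)| then 0
    else candMem g m η x M k
  /-- projection step followed by mixing step -/
  iterate : ∀ k, x (k + 1) =
    (sweep p q (k - M k) (M k) (x k, residual g (x k))).1 +
      β k • (sweep p q (k - M k) (M k) (x k, residual g (x k))).2

/-- The set of all `‖p(A) r‖` for real polynomials `p` of degree at most `n` with `p(0) = 1`. -/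
def polyNorms {E : Type*} [NormedAddCommGroup E] [NormedSpace ℝ E]
    (A : E →L[ℝ] E) (n : ℕ) (r : E) : Set ℝ :=
  {t | ∃ p : ℝ[X], p.natDegree ≤ n ∧ p.eval 0 = 1 ∧ t = ‖aeval A p r‖}

end RestartedAM

/-! Let a cycle start at `x s`, at distance `R` from `xs`, with residual `r`. The eliminations are a
modified Gram–Schmidt process, so the `q i` of the cycle are orthogonal. The tests and the
contraction give `‖q i‖ ≥ σ ‖r‖` with `σ = √τ (1 - κ)`, while all residuals are at most `H ‖r‖` with
`H = max 1 η`. Hence every elimination coefficient is at most `K = 2 H / σ`, and the iterates stay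
within `D R` of `xs`, where `K` and `D` do not involve `κh`.

On that ball the residual map is affine with linear part `-A`, up to `O(κh R²)`. Bounded
coefficients keep this order: the `p i` lie near the Krylov space `K_n(A, r)` and the `q i` near `A
K_n` (`IsTameCycle.near_krylov`). The converse inclusion is the crux. As `A K_n` has dimension at
most `n` and the `q i` are `n` orthogonal vectors that are not small, each element of `A K_n` is
near a combination of them (`exists_combination_near`). Since the projected residual `r̄` has least
norm in `r + span q` (`IsCycle.norm_sweep_le`), `‖r̄‖` is at most the polynomial minimum plus `O(κh
R²)`. The mixing step multiplies `r̄` by `1 - A = g'(xs)`, of norm at most `κ`, up to the same order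
(`IsTameCycle.residual_next`). If `n = d`, the `q i` span the space and `r̄ = 0`.

For small `R` these estimates imply that residual norms do not grow from one cycle start to the
next, so all cycles start near `xs` (`IsRun.start_le`). -/

namespace RestartedAM

/-! ### The elimination loop as Gram–Schmidt. -/

section Sweep

variable {E : Type*} [NormedAddCommGroup E] [InnerProductSpace ℝ E]

lemma norm_sub_proj_le (w q : E) :
    ‖w - (inner ℝ q w / inner ℝ q q : ℝ) • q‖ ≤ ‖w‖ := by
  rcases eq_or_ne q 0 with rfl | hq
  · simp
  have h0 : (inner ℝ q q : ℝ) ≠ 0 := inner_self_ne_zero.mpr hq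
  have h1 : (inner ℝ (w - (inner ℝ q w / inner ℝ q q : ℝ) • q)
      ((inner ℝ q w / inner ℝ q q : ℝ) • q) : ℝ) = 0 := by
    simp only [inner_sub_left, inner_smul_left, inner_smul_right, real_inner_comm q w]
    simp only [conj_trivial]
    field_simp
    ring
  have h2 := norm_add_sq_eq_norm_sq_add_norm_sq_real h1
  rw [sub_add_cancel] at h2
  nlinarith [norm_nonneg w, mul_self_nonneg ‖(inner ℝ q w / inner ℝ q q : ℝ) • q‖,
    norm_nonneg (w - (inner ℝ q w / inner ℝ q q : ℝ) • q)]

lemma norm_sweep_snd_le (p q : ℕ → E) (s n : ℕ) (w : E × E) :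
    ‖(sweep p q s n w).2‖ ≤ ‖w.2‖ := by
  induction n with
  | zero => simp [sweep]
  | succ n ih => exact (norm_sub_proj_le _ _).trans ih

/-- The elimination loop subtracts combinations of the pairs, with the same coefficients in both
components, and these coefficients are controlled by the size of the vectors `q i`. -/
lemma exists_sweep_eq (p q : ℕ → E) (s n : ℕ) (w : E × E) :
    ∃ γ : ℕ → ℝ, (∀ i, |γ i| ≤ ‖w.2‖ / ‖q (s + i + 1)‖) ∧
      (sweep p q s n w).1 = w.1 - ∑ i ∈ Finset.range n, γ i • p (s + i + 1) ∧
      (sweep p q s n w).2 = w.2 - ∑ i ∈ Finset.range n, γ i • q (s + i + 1) := by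
  refine ⟨fun i => inner ℝ (q (s + i + 1)) (sweep p q s i w).2 /
    inner ℝ (q (s + i + 1)) (q (s + i + 1)), fun i => ?_, ?_, ?_⟩
  · dsimp only
    rw [real_inner_self_eq_norm_sq, abs_div, abs_of_nonneg (sq_nonneg ‖q (s + i + 1)‖)]
    rcases eq_or_ne (q (s + i + 1)) 0 with h | h
    · simp [h]
    have hq : 0 < ‖q (s + i + 1)‖ := norm_pos_iff.mpr h
    rw [div_le_div_iff₀ (by positivity) hq]
    have h1 := abs_real_inner_le_norm (q (s + i + 1)) (sweep p q s i w).2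
    have h2 := norm_sweep_snd_le p q s i w
    calc _ ≤ ‖q (s + i + 1)‖ * ‖(sweep p q s i w).2‖ * ‖q (s + i + 1)‖ := by gcongr
      _ ≤ ‖q (s + i + 1)‖ * ‖w.2‖ * ‖q (s + i + 1)‖ := by gcongr
      _ = _ := by ring
  · induction n with
    | zero => simp [sweep]
    | succ n ih => rw [Finset.sum_range_succ, ← sub_sub, ← ih]; rfl
  · induction n with
    | zero => simp [sweep]
    | succ n ih => rw [Finset.sum_range_succ, ← sub_sub, ← ih]; rfl

/-- If the vectors `q i` are pairwise orthogonal, the loop makes the second component orthogonal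
to all of them. -/
lemma inner_sweep_snd (p q : ℕ → E) (s n : ℕ) (w : E × E)
    (hq : ∀ i < n, ∀ j < n, i ≠ j → inner ℝ (q (s + i + 1)) (q (s + j + 1)) = 0) :
    ∀ i < n, inner ℝ (q (s + i + 1)) (sweep p q s n w).2 = (0 : ℝ) := by
  induction n with
  | zero => simp
  | succ n ih =>
    intro i hi
    change inner ℝ (q (s + i + 1)) ((sweep p q s n w).2 -
      (inner ℝ (q (s + n + 1)) (sweep p q s n w).2 /
        inner ℝ (q (s + n + 1)) (q (s + n + 1)) : ℝ) • q (s + n + 1)) = (0 : ℝ)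
    rw [inner_sub_right, inner_smul_right]
    rcases Nat.lt_succ_iff_lt_or_eq.mp hi with h | rfl
    · rw [ih (fun i hi j hj => hq i (by omega) j (by omega)) i h,
        hq i hi n (by omega) (by omega)]
      simp
    · rcases eq_or_ne (q (s + i + 1)) 0 with h0 | h0
      · simp [h0]
      · rw [div_mul_cancel₀ _ (inner_self_ne_zero.mpr h0), sub_self]

end Sweep

/-! ### Residuals of a local contraction. -/

section LocalContraction

variable {E : Type*} [NormedAddCommGroup E] [NormedSpace ℝ E]

/-- The identity dominates the `κ`-contraction `g`. This makes residuals comparable with distances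
and bounds the first `q` of a cycle from below. -/
lemma residual_sub_lower {g : E → E} {xs : E} {ρ κ κh : ℝ}
    (hg : IsLocalContraction g xs ρ κ κh) {x y : E} (hx : ‖x - xs‖ ≤ ρ) (hy : ‖y - xs‖ ≤ ρ) :
    (1 - κ) * ‖y - x‖ ≤ ‖residual g y - residual g x‖ := by
  have h1 := hg.contraction x (mem_closedBall_iff_norm.mpr hx) y (mem_closedBall_iff_norm.mpr hy)
  have h2 : y - x = (g y - g x) - (residual g y - residual g x) := by
    simp only [residual]; abel
  have h3 := norm_sub_le (g y - g x) (residual g y - residual g x)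
  rw [← h2] at h3
  linarith

lemma residual_fixed {g : E → E} {xs : E} {ρ κ κh : ℝ}
    (hg : IsLocalContraction g xs ρ κ κh) : residual g xs = 0 := by
  simp [residual, hg.fixed]

lemma residual_lower {g : E → E} {xs : E} {ρ κ κh : ℝ}
    (hg : IsLocalContraction g xs ρ κ κh) {x : E} (hρ : 0 ≤ ρ) (hx : ‖x - xs‖ ≤ ρ) :
    (1 - κ) * ‖x - xs‖ ≤ ‖residual g x‖ := by
  simpa [residual_fixed hg] using residual_sub_lower hg (x := xs) (by simpa using hρ) hx

lemma residual_upper {g : E → E} {xs : E} {ρ κ κh : ℝ}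
    (hg : IsLocalContraction g xs ρ κ κh) {x : E} (hκ : κ ≤ 1) (hρ : 0 ≤ ρ)
    (hx : ‖x - xs‖ ≤ ρ) : ‖residual g x‖ ≤ 2 * ‖x - xs‖ := by
  have h1 := hg.contraction xs (by simpa using hρ) x (mem_closedBall_iff_norm.mpr hx)
  rw [hg.fixed] at h1
  have h2 : residual g x = (g x - xs) - (x - xs) := by simp only [residual]; abel
  have h3 := norm_sub_le (g x - xs) (x - xs)
  rw [← h2] at h3
  nlinarith [norm_nonneg (x - xs)]

lemma norm_fderiv_le {g : E → E} {xs : E} {ρ κ κh : ℝ}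
    (hg : IsLocalContraction g xs ρ κ κh) (hκ : 0 ≤ κ) (hρ : 0 < ρ) :
    ‖fderiv ℝ g xs‖ ≤ κ := by
  refine norm_fderiv_le_of_lip' ℝ hκ ?_
  filter_upwards [Metric.closedBall_mem_nhds xs hρ] with y hy
  exact hg.contraction xs (Metric.mem_closedBall_self hρ.le) y hy

/-- The residual is `y ↦ -A y` up to an error of second order. -/
lemma residual_linearization {g : E → E} {xs : E} {ρ κ κh : ℝ}
    (hg : IsLocalContraction g xs ρ κ κh) (hκh : 0 ≤ κh) {b : ℝ} (hb : 0 ≤ b) (hbρ : b ≤ ρ)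
    {x y : E} (hx : ‖x - xs‖ ≤ b) (hy : ‖y - xs‖ ≤ b) :
    ‖residual g y - residual g x +
      (ContinuousLinearMap.id ℝ E - fderiv ℝ g xs) (y - x)‖ ≤ 2 * b ^ 2 * κh := by
  have key := (convex_closedBall xs b).norm_image_sub_le_of_norm_fderiv_le' (𝕜 := ℝ) (f := g)
    (φ := fderiv ℝ g xs) (C := κh * b) (x := x) (y := y)
    (fun z hz => hg.differentiable z (Metric.closedBall_subset_closedBall hbρ hz))
    (fun z hz => (hg.jacobian_lipschitz xs (Metric.mem_closedBall_self (hb.trans hbρ)) z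
      (Metric.closedBall_subset_closedBall hbρ hz)).trans
        (mul_le_mul_of_nonneg_left (mem_closedBall_iff_norm.mp hz) hκh))
    (mem_closedBall_iff_norm.mpr hx) (mem_closedBall_iff_norm.mpr hy)
  have h1 : residual g y - residual g x + (ContinuousLinearMap.id ℝ E - fderiv ℝ g xs) (y - x)
      = g y - g x - fderiv ℝ g xs (y - x) := by
    simp only [residual, sub_apply, ContinuousLinearMap.id_apply]; abel
  have h2 : ‖y - x‖ ≤ 2 * b := by
    have := norm_sub_le (y - xs) (x - xs)
    rw [sub_sub_sub_cancel_right] at this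
    linarith
  rw [h1]
  calc _ ≤ κh * b * ‖y - x‖ := key
    _ ≤ κh * b * (2 * b) := by gcongr
    _ = _ := by ring

end LocalContraction

/-! ### Calculus of approximate membership in a subspace. -/

section Near

variable {E : Type*} [NormedAddCommGroup E] [NormedSpace ℝ E]

/-- `v` lies within distance `e` of the subspace `S`. -/
def Near (S : Submodule ℝ E) (e : ℝ) (v : E) : Prop := ∃ u ∈ S, ‖v - u‖ ≤ e

lemma Near.mono {S T : Submodule ℝ E} {e f : ℝ} {v : E} (h : Near S e v) (hST : S ≤ T)
    (hef : e ≤ f) : Near T f v :=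
  let ⟨u, hu, h'⟩ := h
  ⟨u, hST hu, h'.trans hef⟩

lemma near_of_mem {S : Submodule ℝ E} {v : E} (h : v ∈ S) : Near S 0 v := ⟨v, h, by simp⟩

lemma Near.add {S : Submodule ℝ E} {e f : ℝ} {v w : E} (hv : Near S e v) (hw : Near S f w) :
    Near S (e + f) (v + w) := by
  obtain ⟨a, ha, ha'⟩ := hv
  obtain ⟨b, hb, hb'⟩ := hw
  refine ⟨a + b, S.add_mem ha hb, ?_⟩
  rw [add_sub_add_comm]
  exact (norm_add_le _ _).trans (add_le_add ha' hb')

lemma Near.smul {S : Submodule ℝ E} {e K : ℝ} {v : E} (hv : Near S e v) {c : ℝ} (hc : |c| ≤ K) :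
    Near S (K * e) (c • v) := by
  obtain ⟨a, ha, ha'⟩ := hv
  refine ⟨c • a, S.smul_mem c ha, ?_⟩
  rw [← smul_sub, norm_smul, Real.norm_eq_abs]
  exact mul_le_mul hc ha' (norm_nonneg _) ((abs_nonneg c).trans hc)

lemma Near.sub {S : Submodule ℝ E} {e f : ℝ} {v w : E} (hv : Near S e v) (hw : Near S f w) :
    Near S (e + f) (v - w) := by
  have := hv.add (hw.smul (c := -1) (K := 1) (by simp))
  simpa [sub_eq_add_neg] using this

lemma Near.add_norm {S : Submodule ℝ E} {e f : ℝ} {v w : E} (hv : Near S e v)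
    (hw : ‖w - v‖ ≤ f) : Near S (e + f) w := by
  obtain ⟨a, ha, ha'⟩ := hv
  refine ⟨a, ha, ?_⟩
  have := norm_add_le (w - v) (v - a)
  rw [sub_add_sub_cancel] at this
  linarith

lemma near_sum {S : Submodule ℝ E} {e K : ℝ} {γ : ℕ → ℝ} {v : ℕ → E} (n : ℕ)
    (hγ : ∀ i < n, |γ i| ≤ K) (hv : ∀ i < n, Near S e (v i)) :
    Near S (n * K * e) (∑ i ∈ Finset.range n, γ i • v i) := by
  induction n with
  | zero => simpa using near_of_mem S.zero_mem
  | succ n ih =>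
    rw [Finset.sum_range_succ]
    have h1 := ih (fun i hi => hγ i (by omega)) (fun i hi => hv i (by omega))
    have h2 := (hv n (by omega)).smul (hγ n (by omega))
    exact (h1.add h2).mono le_rfl (by push_cast; linarith)

lemma norm_sum_smul_le {e K : ℝ} {γ : ℕ → ℝ} {v : ℕ → E} (n : ℕ)
    (hγ : ∀ i < n, |γ i| ≤ K) (hv : ∀ i < n, ‖v i‖ ≤ e) :
    ‖∑ i ∈ Finset.range n, γ i • v i‖ ≤ n * K * e := by
  -- Distance to the zero subspace is the norm.
  obtain ⟨u, hu, h⟩ := near_sum (S := ⊥) (v := v) n hγ (fun i hi => ⟨0, Submodule.zero_mem _,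
    by simpa using hv i hi⟩)
  simpa [(Submodule.mem_bot ℝ).mp hu] using h

end Near

/-! ### Krylov spaces and residual polynomials. -/

section Krylov

variable {E : Type*} [NormedAddCommGroup E] [NormedSpace ℝ E]

/-- The linear map `p ↦ p(A) r`. -/
noncomputable def polyApply (A : E →L[ℝ] E) (r : E) : ℝ[X] →ₗ[ℝ] E :=
  (ContinuousLinearMap.apply ℝ E r).toLinearMap ∘ₗ (aeval A).toLinearMap

lemma polyApply_apply (A : E →L[ℝ] E) (r : E) (p : ℝ[X]) : polyApply A r p = aeval A p r := rfl

/-- The Krylov space spanned by `r, A r, …, A ^ (n - 1) r`. -/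
noncomputable def krylov (A : E →L[ℝ] E) (r : E) (n : ℕ) : Submodule ℝ E :=
  (degreeLT ℝ n).map (polyApply A r)

lemma krylov_mono (A : E →L[ℝ] E) (r : E) {n k : ℕ} (h : n ≤ k) :
    krylov A r n ≤ krylov A r k :=
  Submodule.map_mono (degreeLT_mono h)

lemma mem_krylov_succ (A : E →L[ℝ] E) (r : E) (n : ℕ) : r ∈ krylov A r (n + 1) :=
  ⟨1, by
    rw [SetLike.mem_coe, mem_degreeLT]
    exact degree_one_le.trans_lt (by exact_mod_cast Nat.succ_pos n), by simp [polyApply_apply]⟩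

lemma map_krylov_le (A : E →L[ℝ] E) (r : E) (n : ℕ) :
    (krylov A r n).map A.toLinearMap ≤ krylov A r (n + 1) := by
  rintro _ ⟨_, ⟨p, hp, rfl⟩, rfl⟩
  refine ⟨X * p, ?_, by simp [polyApply_apply]⟩
  rw [SetLike.mem_coe, mem_degreeLT] at hp ⊢
  rcases eq_or_ne p 0 with rfl | h0
  · simp
  · rw [degree_mul, degree_X, degree_eq_natDegree h0] at *
    norm_cast at *
    omega

instance finiteDimensional_degreeLT (n : ℕ) : FiniteDimensional ℝ (degreeLT ℝ n) :=
  Module.Finite.equiv (degreeLTEquiv ℝ n).symm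

instance finiteDimensional_krylov (A : E →L[ℝ] E) (r : E) (n : ℕ) :
    FiniteDimensional ℝ (krylov A r n) := by
  unfold krylov; infer_instance

lemma finrank_map_krylov_le (A : E →L[ℝ] E) (r : E) (n : ℕ) :
    Module.finrank ℝ ((krylov A r n).map A.toLinearMap) ≤ n := by
  refine (Submodule.finrank_map_le _ _).trans ((Submodule.finrank_map_le _ _).trans ?_)
  rw [(degreeLTEquiv ℝ n).finrank_eq]
  simp

/-- The values `p(A) r` for `deg p ≤ n`, `p(0) = 1` form the affine space `r + A K_n`. -/
lemma polyNorms_eq (A : E →L[ℝ] E) (n : ℕ) (r : E) :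
    polyNorms A n r = {t | ∃ w ∈ (krylov A r n).map A.toLinearMap, t = ‖r + w‖} := by
  ext t
  constructor
  · rintro ⟨p, hp, hp0, rfl⟩
    refine ⟨aeval A p r - r, ?_, by simp⟩
    -- `p(0) = 1` means `p = 1 + X * divX p`.
    refine ⟨polyApply A r (divX p), ⟨divX p, ?_, rfl⟩, ?_⟩
    · rw [SetLike.mem_coe, mem_degreeLT]
      rcases eq_or_ne (divX p) 0 with h0 | h0
      · rw [h0, degree_zero]; exact WithBot.bot_lt_coe n
      · rw [degree_eq_natDegree h0, natDegree_divX_eq_natDegree_tsub_one]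
        have : p.natDegree ≠ 0 := by
          intro h
          apply h0
          rw [eq_C_of_natDegree_eq_zero h, divX_C]
        norm_cast
        omega
    · have h1 : p = X * divX p + 1 := by
        conv_lhs => rw [← X_mul_divX_add p]
        rw [coeff_zero_eq_eval_zero, hp0, C_1]
      conv_rhs => rw [h1]
      simp [polyApply_apply]
  · rintro ⟨_, ⟨_, ⟨p, hp, rfl⟩, rfl⟩, rfl⟩
    refine ⟨X * p + 1, ?_, by simp, by simp [polyApply_apply, add_comm]⟩
    rw [SetLike.mem_coe, mem_degreeLT] at hp
    rcases eq_or_ne p 0 with rfl | h0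
    · simp
    · refine (natDegree_add_le _ _).trans ?_
      rw [degree_eq_natDegree h0] at hp
      rw [natDegree_X_mul h0, natDegree_one]
      norm_cast at hp

end Krylov

/-! ### Least norms and approximation by orthogonal vectors. -/

section Approx

variable {E : Type*} [NormedAddCommGroup E] [InnerProductSpace ℝ E]

lemma exists_isLeast_polyNorms (A : E →L[ℝ] E) (n : ℕ) (r : E) :
    ∃ w ∈ (krylov A r n).map A.toLinearMap, IsLeast (polyNorms A n r) ‖r + w‖ := by
  set V := (krylov A r n).map A.toLinearMap with hV
  refine ⟨-V.starProjection r, V.neg_mem (V.starProjection_apply_mem r), ?_, ?_⟩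
  · rw [polyNorms_eq]
    exact ⟨_, V.neg_mem (V.starProjection_apply_mem r), rfl⟩
  · rw [polyNorms_eq]
    rintro _ ⟨w, hw, rfl⟩
    rw [← sub_eq_add_neg, V.starProjection_minimal]
    have := ciInf_le (f := fun v : V => ‖r - v‖) ⟨0, by rintro _ ⟨v, rfl⟩; positivity⟩
      ⟨-w, V.neg_mem hw⟩
    simpa using this

lemma abs_coeff_mul_norm_le {n : ℕ} {q : Fin n → E}
    (hq : ∀ i j, i ≠ j → inner ℝ (q i) (q j) = (0 : ℝ)) (c : Fin n → ℝ) (i : Fin n) :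
    |c i| * ‖q i‖ ≤ ‖∑ j, c j • q j‖ := by
  have h1 : inner ℝ (q i) (∑ j, c j • q j) = c i * ‖q i‖ ^ 2 := by
    rw [inner_sum, Finset.sum_eq_single i]
    · rw [inner_smul_right, real_inner_self_eq_norm_sq]
    · intro j _ hj
      rw [inner_smul_right, hq i j hj.symm, mul_zero]
    · simp
  have h2 := abs_real_inner_le_norm (q i) (∑ j, c j • q j)
  rw [h1, abs_mul, abs_of_nonneg (sq_nonneg ‖q i‖)] at h2
  rcases (norm_nonneg (q i)).eq_or_lt with h | h
  · rw [← h]; simp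
  · refine le_of_mul_le_mul_left ?_ h
    linarith

/-- A subspace of dimension at most `n` close to `n` orthogonal vectors is close to their span. -/
lemma exists_combination_near {n : ℕ} {q : Fin n → E} {V : Submodule ℝ E}
    [FiniteDimensional ℝ V] (hV : Module.finrank ℝ V ≤ n)
    (hq : ∀ i j, i ≠ j → inner ℝ (q i) (q j) = (0 : ℝ)) {l a : ℝ} (hl : 0 < l)
    (hql : ∀ i, l ≤ ‖q i‖) (hqV : ∀ i, Near V a (q i)) (ha : 2 * (n * a) ≤ l) {w : E}
    (hw : w ∈ V) : ∃ c : Fin n → ℝ, ‖∑ i, c i • q i - w‖ ≤ a * (2 * n * ‖w‖ / l) := by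
  choose v hv hva using hqV
  -- Orthogonality bounds the coefficients by `∑ c i • q i`; replacing `q i` by `v i` costs `a * ∑
  -- |c i|`, which `2 * (n * a) ≤ l` absorbs.
  have bound : ∀ c : Fin n → ℝ, (∑ i, |c i|) * l ≤ 2 * n * ‖∑ i, c i • v i‖ ∧
      ‖∑ i, c i • q i - ∑ i, c i • v i‖ ≤ a * ∑ i, |c i| := by
    intro c
    have h1 : ‖∑ i, c i • q i - ∑ i, c i • v i‖ ≤ a * ∑ i, |c i| := by
      rw [← Finset.sum_sub_distrib, Finset.mul_sum]
      refine norm_sum_le_of_le _ fun i _ => ?_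
      rw [← smul_sub, norm_smul, Real.norm_eq_abs, mul_comm]
      exact mul_le_mul_of_nonneg_right (hva i) (abs_nonneg _)
    refine ⟨?_, h1⟩
    have h2 : (∑ i, |c i|) * l ≤ n * ‖∑ i, c i • q i‖ := by
      rw [Finset.sum_mul]
      refine (Finset.sum_le_card_nsmul _ _ ‖∑ i, c i • q i‖ fun i _ => ?_).trans_eq (by simp)
      exact (mul_le_mul_of_nonneg_left (hql i) (abs_nonneg _)).trans
        (abs_coeff_mul_norm_le hq c i)
    have h3 : ‖∑ i, c i • q i‖ ≤ a * (∑ i, |c i|) + ‖∑ i, c i • v i‖ := by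
      have := norm_add_le (∑ i, c i • q i - ∑ i, c i • v i) (∑ i, c i • v i)
      rw [sub_add_cancel] at this
      linarith
    have h4 : 0 ≤ ∑ i, |c i| := Finset.sum_nonneg fun i _ => abs_nonneg _
    have h5 := mul_le_mul_of_nonneg_left h3 (Nat.cast_nonneg (α := ℝ) n)
    have h6 := mul_le_mul_of_nonneg_right ha h4
    nlinarith
  let v' : Fin n → V := fun i => ⟨v i, hv i⟩
  -- The nearby vectors `v i ∈ V` are still independent, hence a basis of `V` by the dimension
  -- bound; the coordinates of `w` in it serve for the `q i`.
  have hli : LinearIndependent ℝ v' := by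
    rw [Fintype.linearIndependent_iff]
    intro c hc i
    have h0 : ∑ i, c i • v i = 0 := by
      have := congrArg V.subtype hc
      simpa [v'] using this
    have h1 := (bound c).1
    rw [h0, norm_zero, mul_zero] at h1
    have h2 : ∑ i, |c i| ≤ 0 := by
      by_contra h
      push Not at h
      nlinarith [mul_pos h hl]
    have h3 := Finset.single_le_sum (f := fun i => |c i|) (fun i _ => abs_nonneg _)
      (Finset.mem_univ i)
    exact abs_nonpos_iff.mp (h3.trans h2)
  have hspan : Submodule.span ℝ (Set.range v') = ⊤ := by
    apply hli.span_eq_top_of_card_eq_finrank'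
    refine le_antisymm hli.fintype_card_le_finrank (by simpa using hV)
  have hw' : (⟨w, hw⟩ : V) ∈ Submodule.span ℝ (Set.range v') := hspan ▸ Submodule.mem_top
  obtain ⟨c, hc⟩ := (Submodule.mem_span_range_iff_exists_fun ℝ).mp hw'
  have hc' : ∑ i, c i • v i = w := by
    have := congrArg V.subtype hc
    simpa [v'] using this
  refine ⟨c, ?_⟩
  obtain ⟨h1, h2⟩ := bound c
  rw [hc'] at h1 h2
  -- `0 ≤ a` is read off from some `q i`, so the empty family is separate.
  rcases Nat.eq_zero_or_pos n with rfl | hn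
  · simpa using h2
  refine h2.trans (mul_le_mul_of_nonneg_left ?_ ((norm_nonneg _).trans (hva ⟨0, hn⟩)))
  rwa [le_div_iff₀ hl]

end Approx

end RestartedAM

/-! ### Cycles of a run and the restart tests. -/

namespace RestartedAM

variable {E : Type*} [NormedAddCommGroup E] [InnerProductSpace ℝ E]

/-- The data of one cycle of the method, restarted in iteration `s` and followed up to iteration
`s + n`, with the consequences of the restart tests. -/
structure IsCycle (g : E → E) (x p q : ℕ → E) (s n : ℕ) (τ H : ℝ) : Prop where
  pair : ∀ j < n, (p (s + j + 1), q (s + j + 1)) = sweep p q s j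
    (x (s + j + 1) - x (s + j), residual g (x (s + j + 1)) - residual g (x (s + j)))
  large : ∀ j < n, τ * ‖q (s + 1)‖ ^ 2 ≤ ‖q (s + j + 1)‖ ^ 2
  growth : ∀ j ≤ n, ‖residual g (x (s + j))‖ ≤ H * ‖residual g (x s)‖
  iterate : ∀ j ≤ n, x (s + j + 1) = (sweep p q s j (x (s + j), residual g (x (s + j)))).1 +
    (sweep p q s j (x (s + j), residual g (x (s + j)))).2

section Run

variable {g : E → E} {β : ℕ → ℝ} {m : ℕ} {τ η : ℝ} {x p q : ℕ → E} {M : ℕ → ℕ}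

lemma IsRun.candMem_eq (h : IsRun g β m τ η x p q M) {k : ℕ} (hk : 0 < M k) :
    candMem g m η x M k = M k := by
  have := h.memory k
  split_ifs at this with h1
  · omega
  · exact this.symm

lemma IsRun.entryMem_eq (h : IsRun g β m τ η x p q M) {k : ℕ} (hk : 0 < M k) :
    entryMem M k = M k ∧ M k ≤ m ∧
      ‖residual g (x k)‖ ≤ η * ‖residual g (x (k - M k))‖ := by
  have h1 := h.candMem_eq hk
  unfold candMem at h1
  split_ifs at h1 with h2
  · omega
  · push Not at h2
    rw [h1] at h2
    exact ⟨h1, h2⟩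

lemma IsRun.memory_le (h : IsRun g β m τ η x p q M) (k : ℕ) : M k ≤ m := by
  rcases Nat.eq_zero_or_pos (M k) with h0 | h0
  · omega
  · exact (h.entryMem_eq h0).2.1

lemma IsRun.memory_zero (h : IsRun g β m τ η x p q M) : M 0 = 0 := by
  by_contra h0
  have := (h.entryMem_eq (Nat.pos_of_ne_zero h0)).1
  simp only [entryMem] at this
  omega

lemma IsRun.memory_succ (h : IsRun g β m τ η x p q M) {k : ℕ} (hk : 0 < M (k + 1)) :
    M (k + 1) = M k + 1 :=
  (h.entryMem_eq hk).1.symm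

lemma IsRun.memory_le_index (h : IsRun g β m τ η x p q M) (k : ℕ) : M k ≤ k := by
  induction k with
  | zero => exact h.memory_zero.le
  | succ k ih =>
    rcases Nat.eq_zero_or_pos (M (k + 1)) with h0 | h0
    · omega
    · rw [h.memory_succ h0]; omega

lemma IsRun.memory_sub (h : IsRun g β m τ η x p q M) (k j : ℕ) (hj : j ≤ M k) :
    M (k - j) = M k - j := by
  induction j with
  | zero => simp
  | succ j ih =>
    have h1 := ih (by omega)
    have h2 := h.memory_le_index k
    obtain ⟨l, hl⟩ : ∃ l, k - j = l + 1 := ⟨k - j - 1, by omega⟩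
    have h3 : k - (j + 1) = l := by omega
    rw [hl] at h1
    have := h.memory_succ (k := l) (by omega)
    rw [h3]
    omega

lemma IsRun.isCycle (h : IsRun g (fun _ => 1) m τ η x p q M) (k : ℕ) :
    IsCycle g x p q (k - M k) (M k) τ (max 1 η) := by
  have hMk := h.memory_le_index k
  obtain ⟨s, hs⟩ : ∃ s, k = s + M k := ⟨k - M k, by omega⟩
  have hs' : k - M k = s := by omega
  have hM : ∀ j ≤ M k, M (s + j) = j := fun j hj => by
    have := h.memory_sub k (M k - j) (by omega)
    rw [show k - (M k - j) = s + j by omega] at this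
    omega
  rw [hs']
  have act : ∀ j, j < M k → 0 < M (s + j + 1) ∧ M (s + j + 1) = j + 1 := fun j hj => by
    have := hM (j + 1) (by omega)
    rw [← add_assoc] at this
    omega
  refine ⟨fun j hj => ?_, fun j hj => ?_, fun j hj => ?_, fun j hj => ?_⟩
  · obtain ⟨h1, h2⟩ := act j hj
    have h3 := h.pair (s + j + 1) (by rw [h.candMem_eq h1]; exact h1)
    rw [h.candMem_eq h1, h2] at h3
    rw [h3]
    congr 1
    omega
  · obtain ⟨h1, h2⟩ := act j hj
    have h3 := h.memory (s + j + 1)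
    rw [h.candMem_eq h1, h2, show s + j + 1 - (j + 1) + 1 = s + 1 by omega] at h3
    split_ifs at h3 with h4
    push Not at h4
    have h5 := h4 (by omega)
    rwa [real_inner_self_eq_norm_sq, real_inner_self_eq_norm_sq, abs_of_nonneg (sq_nonneg _),
      abs_of_nonneg (sq_nonneg _)] at h5
  · rcases j with _ | j
    -- At the start of the cycle no growth test applies; hence the `1` in `max 1 η`.
    · simpa using le_mul_of_one_le_left (norm_nonneg (residual g (x s))) (le_max_left 1 η)
    · obtain ⟨h1, h2⟩ := act j (by omega)
      have h3 := (h.entryMem_eq h1).2.2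
      rw [h2, show s + j + 1 - (j + 1) = s by omega] at h3
      exact h3.trans (mul_le_mul_of_nonneg_right (le_max_right _ _) (norm_nonneg _))
  · have h3 := h.iterate (s + j)
    rwa [hM j hj, one_smul, Nat.add_sub_cancel] at h3

end Run

/-! ### Geometry and linearization of one cycle. -/

section Cycle

variable {g : E → E} {x p q : ℕ → E} {s n : ℕ} {τ H : ℝ}

lemma IsCycle.inner_eq_zero (hc : IsCycle g x p q s n τ H) :
    ∀ i < n, ∀ j < n, i ≠ j → inner ℝ (q (s + i + 1)) (q (s + j + 1)) = (0 : ℝ) := by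
  suffices key : ∀ k ≤ n, ∀ i < k, ∀ j < k, i ≠ j →
      inner ℝ (q (s + i + 1)) (q (s + j + 1)) = (0 : ℝ) from key n le_rfl
  intro k
  induction k with
  | zero => intro _ i hi; omega
  | succ k ih =>
    intro hk
    have h1 : ∀ i < k, inner ℝ (q (s + i + 1)) (q (s + k + 1)) = (0 : ℝ) := fun i hi => by
      have h2 : q (s + k + 1) = _ := congrArg Prod.snd (hc.pair k hk)
      rw [h2]
      exact inner_sweep_snd p q s k _ (ih (by omega)) i hi
    intro i hi j hj hij
    rcases Nat.lt_succ_iff_lt_or_eq.mp hi with hi' | rfl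
    · rcases Nat.lt_succ_iff_lt_or_eq.mp hj with hj' | rfl
      · exact ih (by omega) i hi' j hj' hij
      · exact h1 i hi'
    · rw [real_inner_comm]
      exact h1 j (by omega)

lemma IsCycle.iterate_zero (hc : IsCycle g x p q s n τ H) :
    x (s + 1) = x s + residual g (x s) := by
  simpa [sweep] using hc.iterate 0 (Nat.zero_le n)

/-- Each residual difference is its `q` plus a combination of earlier ones; telescope. -/
lemma IsCycle.residual_sub_mem_span (hc : IsCycle g x p q s n τ H) :
    residual g (x (s + n)) - residual g (x s) ∈
      Submodule.span ℝ (Set.range fun i : Fin n => q (s + i + 1)) := by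
  suffices key : ∀ j ≤ n, residual g (x (s + j)) - residual g (x s) ∈
      Submodule.span ℝ (Set.range fun i : Fin n => q (s + i + 1)) from key n le_rfl
  have hmem : ∀ i < n, q (s + i + 1) ∈
      Submodule.span ℝ (Set.range fun i : Fin n => q (s + i + 1)) := fun i hi =>
    Submodule.subset_span ⟨⟨i, hi⟩, rfl⟩
  intro j
  induction j with
  | zero => simp
  | succ j ih =>
    intro hj
    obtain ⟨γ, -, -, h⟩ := exists_sweep_eq p q s j
      (x (s + j + 1) - x (s + j), residual g (x (s + j + 1)) - residual g (x (s + j)))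
    rw [← hc.pair j hj] at h
    dsimp only at h
    have h1 := ih (by omega)
    have h2 : residual g (x (s + (j + 1))) - residual g (x s) =
        (q (s + j + 1) + ∑ i ∈ Finset.range j, γ i • q (s + i + 1)) +
          (residual g (x (s + j)) - residual g (x s)) := by
      rw [h, ← add_assoc]; abel
    rw [h2]
    refine add_mem (add_mem (hmem j hj) (sum_mem fun i hi => ?_)) h1
    exact Submodule.smul_mem _ _ (hmem i (by have := Finset.mem_range.mp hi; omega))

/-- The vector `r̄` obtained by projecting out the pairs of the cycle is the element of smallest
norm in the affine space spanned by the residuals. -/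
lemma IsCycle.norm_sweep_le (hc : IsCycle g x p q s n τ H) (c : Fin n → ℝ) :
    ‖(sweep p q s n (x (s + n), residual g (x (s + n)))).2‖ ≤
      ‖residual g (x s) + ∑ i, c i • q (s + i + 1)‖ := by
  set b := (sweep p q s n (x (s + n), residual g (x (s + n)))).2 with hb
  set W := Submodule.span ℝ (Set.range fun i : Fin n => q (s + i + 1)) with hW
  have horth : ∀ z ∈ W, inner ℝ z b = (0 : ℝ) := by
    intro z hz
    induction hz using Submodule.span_induction with
    | mem z hz =>
      obtain ⟨i, rfl⟩ := hz
      exact inner_sweep_snd p q s n _ hc.inner_eq_zero i i.2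
    | zero => simp
    | add y z _ _ hy hz => rw [inner_add_left, hy, hz, add_zero]
    | smul a y _ hy => rw [inner_smul_left, hy, mul_zero]
  have hmem : ∀ i < n, q (s + i + 1) ∈ W := fun i hi => Submodule.subset_span ⟨⟨i, hi⟩, rfl⟩
  have hz : residual g (x s) + ∑ i, c i • q (s + i + 1) - b ∈ W := by
    obtain ⟨γ, -, -, h⟩ := exists_sweep_eq p q s n (x (s + n), residual g (x (s + n)))
    rw [← hb] at h
    have h2 : residual g (x s) + ∑ i : Fin n, c i • q (s + i + 1) - b =
        ∑ i : Fin n, c i • q (s + i + 1) + ∑ i ∈ Finset.range n, γ i • q (s + i + 1) -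
          (residual g (x (s + n)) - residual g (x s)) := by
      rw [h]; abel
    rw [h2]
    refine sub_mem (add_mem (sum_mem fun i _ => W.smul_mem _ (hmem i i.2))
      (sum_mem fun i hi => W.smul_mem _ (hmem i (Finset.mem_range.mp hi))))
      hc.residual_sub_mem_span
  -- Pythagoras: `b` is orthogonal to `W`, and every competitor differs from `b` by an element of
  -- `W`.
  have h3 := norm_add_sq_eq_norm_sq_add_norm_sq_real (horth _ hz)
  rw [sub_add_cancel] at h3
  refine le_of_sq_le_sq ?_ (norm_nonneg _)
  nlinarith [mul_self_nonneg ‖residual g (x s) + ∑ i : Fin n, c i • q (s + i + 1) - b‖]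

/-- Bound for iterates and pairs in a cycle, in units of the distance at the start of the cycle. -/
noncomputable def cycleBound (K H : ℝ) : ℕ → ℝ
  | 0 => 1
  | j + 1 => (2 + 2 * (j * K)) * cycleBound K H j + 2 * H

lemma cycleBound_pos {K H : ℝ} (hK : 0 ≤ K) (hH : 0 ≤ H) (j : ℕ) : 1 ≤ cycleBound K H j := by
  induction j with
  | zero => exact le_rfl
  | succ j ih =>
    have : 0 ≤ (j * K) * cycleBound K H j := by positivity
    rw [cycleBound]
    nlinarith

lemma cycleBound_mono {K H : ℝ} (hK : 0 ≤ K) (hH : 0 ≤ H) : Monotone (cycleBound K H) := by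
  refine monotone_nat_of_le_succ fun j => ?_
  have h1 := cycleBound_pos hK hH j
  have : 0 ≤ (j * K) * cycleBound K H j := by positivity
  rw [cycleBound]
  nlinarith

/-- The hypotheses of the bounds below: the pairs of the cycle dominate its residuals. -/
structure IsTameCycle (g : E → E) (xs : E) (x p q : ℕ → E) (s n : ℕ) (τ H K : ℝ) : Prop
    extends IsCycle g x p q s n τ H where
  coeff : ∀ i < n, 2 * (H * ‖residual g (x s)‖) ≤ K * ‖q (s + i + 1)‖
  start : ‖residual g (x s)‖ ≤ 2 * ‖x s - xs‖
  nonneg_K : 0 ≤ K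
  nonneg_H : 0 ≤ H

variable {xs : E} {K : ℝ}

/-- The coefficients in the elimination loops of a cycle are bounded. -/
lemma IsTameCycle.exists_sweep_eq (hc : IsTameCycle g xs x p q s n τ H K) {j : ℕ} (hj : j ≤ n)
    {w : E × E} (hw : ‖w.2‖ ≤ 2 * (H * ‖residual g (x s)‖)) :
    ∃ γ : ℕ → ℝ, (∀ i < j, |γ i| ≤ K) ∧
      (sweep p q s j w).1 = w.1 - ∑ i ∈ Finset.range j, γ i • p (s + i + 1) ∧
      (sweep p q s j w).2 = w.2 - ∑ i ∈ Finset.range j, γ i • q (s + i + 1) := by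
  obtain ⟨γ, h1, h2⟩ := RestartedAM.exists_sweep_eq p q s j w
  refine ⟨γ, fun i hi => (h1 i).trans ?_, h2⟩
  exact div_le_of_le_mul₀ (norm_nonneg _) hc.nonneg_K
    (hw.trans (hc.coeff i (by omega)))

lemma IsTameCycle.norm_residual_le (hc : IsTameCycle g xs x p q s n τ H K) {j : ℕ} (hj : j ≤ n) :
    ‖residual g (x (s + j))‖ ≤ 2 * (H * ‖residual g (x s)‖) := by
  have := hc.growth j hj
  have := norm_nonneg (residual g (x (s + j)))
  linarith

lemma IsTameCycle.norm_residual_sub_le (hc : IsTameCycle g xs x p q s n τ H K) {j : ℕ}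
    (hj : j < n) :
    ‖residual g (x (s + j + 1)) - residual g (x (s + j))‖ ≤ 2 * (H * ‖residual g (x s)‖) := by
  have h1 := hc.growth j (by omega)
  have h2 := hc.growth (j + 1) hj
  have := norm_sub_le (residual g (x (s + j + 1))) (residual g (x (s + j)))
  rw [← add_assoc] at h2
  linarith

/-- Kept apart from `bounds` because it also serves for the iterate after the last pair. -/
lemma IsTameCycle.norm_iterate_sub_le (hc : IsTameCycle g xs x p q s n τ H K) {b : ℝ} {j : ℕ}
    (hj : j ≤ n) (hx : ‖x (s + j) - xs‖ ≤ b) (hp : ∀ i < j, ‖p (s + i + 1)‖ ≤ b) :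
    ‖x (s + j + 1) - xs‖ ≤ b + j * K * b + 2 * H * ‖x s - xs‖ := by
  obtain ⟨γ, hγ, h1, -⟩ := hc.exists_sweep_eq hj (w := (x (s + j), residual g (x (s + j))))
    (hc.norm_residual_le hj)
  have h2 : ‖(sweep p q s j (x (s + j), residual g (x (s + j)))).2‖ ≤ 2 * H * ‖x s - xs‖ := by
    refine (norm_sweep_snd_le p q s j _).trans ((hc.growth j hj).trans ?_)
    nlinarith [hc.start, hc.nonneg_H]
  have h3 := norm_sum_smul_le j hγ hp
  rw [hc.iterate j hj, h1]
  dsimp only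
  generalize (sweep p q s j (x (s + j), residual g (x (s + j)))).2 = r at *
  generalize ∑ i ∈ Finset.range j, γ i • p (s + i + 1) = y at *
  have h4 : x (s + j) - y + r - xs = (x (s + j) - xs - y) + r := by abel
  rw [h4]
  have := norm_add_le (x (s + j) - xs - y) r
  have := norm_sub_le (x (s + j) - xs) y
  linarith

/-- Iterates and pairs need a joint induction: a new iterate uses the old pairs, and a new pair uses
two iterates and the old pairs. This produces the recursion of `cycleBound`. -/
lemma IsTameCycle.bounds (hc : IsTameCycle g xs x p q s n τ H K) {j : ℕ} (hj : j ≤ n) :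
    (∀ i ≤ j, ‖x (s + i) - xs‖ ≤ cycleBound K H j * ‖x s - xs‖) ∧
      ∀ i < j, ‖p (s + i + 1)‖ ≤ cycleBound K H j * ‖x s - xs‖ := by
  have hK := hc.nonneg_K
  have hH := hc.nonneg_H
  induction j with
  | zero => simp [cycleBound]
  | succ j ih =>
    obtain ⟨hx, hp⟩ := ih (by omega)
    have hmono : cycleBound K H j * ‖x s - xs‖ ≤ cycleBound K H (j + 1) * ‖x s - xs‖ :=
      mul_le_mul_of_nonneg_right (cycleBound_mono hK hH j.le_succ) (norm_nonneg _)
    have hx1 := hc.norm_iterate_sub_le (by omega) (hx j le_rfl) hp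
    have hb : 0 ≤ cycleBound K H j * ‖x s - xs‖ :=
      mul_nonneg (zero_le_one.trans (cycleBound_pos hK hH j)) (norm_nonneg _)
    have hjK : 0 ≤ j * K * (cycleBound K H j * ‖x s - xs‖) := by positivity
    have hrec : cycleBound K H (j + 1) * ‖x s - xs‖ =
        2 * (cycleBound K H j * ‖x s - xs‖) + 2 * (j * K * (cycleBound K H j * ‖x s - xs‖)) +
          2 * H * ‖x s - xs‖ := by
      rw [cycleBound]; ring
    refine ⟨fun i hi => ?_, fun i hi => ?_⟩
    · rcases Nat.le_succ_iff.mp hi with h | rfl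
      · exact (hx i h).trans hmono
      · rw [Nat.succ_eq_add_one, ← add_assoc]
        linarith
    · rcases Nat.lt_succ_iff_lt_or_eq.mp hi with h | rfl
      · exact (hp i h).trans hmono
      · obtain ⟨γ, hγ, h1, -⟩ := hc.exists_sweep_eq (j := i) (by omega)
          (w := (_, _)) (hc.norm_residual_sub_le (j := i) (by omega))
        rw [← hc.pair i (by omega)] at h1
        dsimp only at h1
        rw [h1]
        have h3 := norm_sum_smul_le i hγ hp
        have h4 := norm_sub_le (x (s + i + 1) - x (s + i))
          (∑ k ∈ Finset.range i, γ k • p (s + k + 1))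
        have h5 := norm_sub_le (x (s + i + 1) - xs) (x (s + i) - xs)
        rw [sub_sub_sub_cancel_right] at h5
        have h6 := hx i le_rfl
        linarith

/-- Error constant for the approximation of a cycle by its linearization. -/
noncomputable def krylovBound (K D : ℝ) : ℕ → ℝ
  | 0 => 0
  | j + 1 => (4 + 5 * (j * K)) * krylovBound K D j + 2 * D ^ 2

lemma krylovBound_nonneg {K : ℝ} (D : ℝ) (hK : 0 ≤ K) (j : ℕ) : 0 ≤ krylovBound K D j := by
  induction j with
  | zero => exact le_rfl
  | succ j ih => rw [krylovBound]; positivity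

lemma krylovBound_mono {K : ℝ} (D : ℝ) (hK : 0 ≤ K) : Monotone (krylovBound K D) := by
  refine monotone_nat_of_le_succ fun j => ?_
  have h1 := krylovBound_nonneg D hK j
  have : 0 ≤ (j * K) * krylovBound K D j := by positivity
  rw [krylovBound]
  nlinarith [sq_nonneg D]

/-- If the residual differences along a cycle are given by `-A` up to `2 D² ε`, then the pairs lie
close to the Krylov spaces of `A`. -/
lemma IsTameCycle.near_krylov (hc : IsTameCycle g xs x p q s n τ H K) {A : E →L[ℝ] E}
    (hA : ‖A‖ ≤ 2) {D ε : ℝ} (hε : 0 ≤ ε)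
    (hlin : ∀ i ≤ n, ∀ j ≤ n, ‖residual g (x (s + j)) - residual g (x (s + i)) +
      A (x (s + j) - x (s + i))‖ ≤ 2 * D ^ 2 * ε) {j : ℕ} (hj : j ≤ n) :
    Near (krylov A (residual g (x s)) j) (krylovBound K D j * ε) (x (s + j) - x s) ∧
      (∀ i < j, Near (krylov A (residual g (x s)) j) (krylovBound K D j * ε) (p (s + i + 1))) ∧
      ∀ i < j, ‖q (s + i + 1) + A (p (s + i + 1))‖ ≤ krylovBound K D j * ε := by
  have hK := hc.nonneg_K
  set r := residual g (x s) with hr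
  induction j with
  | zero => simpa [krylovBound] using near_of_mem (Submodule.zero_mem _)
  | succ j ih =>
    obtain ⟨hx, hp, hq⟩ := ih (by omega)
    have hmono : krylovBound K D j * ε ≤ krylovBound K D (j + 1) * ε :=
      mul_le_mul_of_nonneg_right (krylovBound_mono D hK j.le_succ) hε
    have hspace := krylov_mono A r j.le_succ
    set c := krylovBound K D j * ε with hcdef
    have hc0 : 0 ≤ c := mul_nonneg (krylovBound_nonneg D hK j) hε
    have hjK : 0 ≤ j * K * c := by positivity
    have hDε : 0 ≤ 2 * D ^ 2 * ε := by positivity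
    have hrec : krylovBound K D (j + 1) * ε = 4 * c + 5 * (j * K * c) + 2 * D ^ 2 * ε := by
      rw [krylovBound, hcdef]; ring
    have hmap : ∀ {e : ℝ} {v : E}, Near (krylov A r j) e v →
        Near (krylov A r (j + 1)) (2 * e) (-A v) := by
      rintro e v ⟨u, hu, huv⟩
      refine ⟨-A u, neg_mem (map_krylov_le A r j ⟨u, hu, rfl⟩), ?_⟩
      rw [neg_sub_neg, ← map_sub]
      refine (A.le_opNorm _).trans ?_
      rw [norm_sub_rev]
      exact mul_le_mul hA huv (norm_nonneg _) zero_le_two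
    have hqn : ∀ i < j, Near (krylov A r (j + 1)) (3 * c) (q (s + i + 1)) := fun i hi => by
      refine ((hmap (hp i hi)).add_norm (w := q (s + i + 1)) (f := c) ?_).mono le_rfl
        (by linarith)
      rw [sub_neg_eq_add]
      exact hq i hi
    -- The residual is `r - A (x (s + j) - x s)` up to the linearization error.
    have hrn : Near (krylov A r (j + 1)) (2 * c + 2 * D ^ 2 * ε) (residual g (x (s + j))) := by
      have h1 := hlin 0 (by omega) j (by omega)
      rw [add_zero] at h1
      have h2 := (hmap hx).add_norm (w := residual g (x (s + j)) - r)
        (f := 2 * D ^ 2 * ε) (by rwa [sub_neg_eq_add])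
      have h3 := h2.add (near_of_mem (mem_krylov_succ A r j))
      rwa [sub_add_cancel, add_zero] at h3
    have hx1 : Near (krylov A r (j + 1)) (3 * c + 4 * (j * K * c) + 2 * D ^ 2 * ε)
        (x (s + j + 1) - x s) := by
      obtain ⟨γ, hγ, h1, h2⟩ := hc.exists_sweep_eq (j := j) (by omega)
        (w := (x (s + j), residual g (x (s + j)))) (hc.norm_residual_le (by omega))
      have h3 : x (s + j + 1) - x s = (x (s + j) - x s) -
          ∑ i ∈ Finset.range j, γ i • p (s + i + 1) + (residual g (x (s + j)) -
          ∑ i ∈ Finset.range j, γ i • q (s + i + 1)) := by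
        rw [hc.iterate j (by omega), h1, h2]
        abel
      rw [h3]
      refine (((hx.mono hspace le_rfl).sub (near_sum j hγ fun i hi =>
        (hp i hi).mono hspace le_rfl)).add (hrn.sub (near_sum j hγ hqn))).mono le_rfl ?_
      apply le_of_eq
      ring
    obtain ⟨γ, hγ, h1, h2⟩ := hc.exists_sweep_eq (j := j) (by omega)
      (w := (_, _)) (hc.norm_residual_sub_le (j := j) (by omega))
    rw [← hc.pair j (by omega)] at h1 h2
    dsimp only at h1 h2
    refine ⟨?_, fun i hi => ?_, fun i hi => ?_⟩
    · rw [← add_assoc]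
      exact hx1.mono le_rfl (by linarith)
    · rcases Nat.lt_succ_iff_lt_or_eq.mp hi with h | rfl
      · exact (hp i h).mono hspace hmono
      · rw [h1]
        have h3 : x (s + i + 1) - x (s + i) = (x (s + i + 1) - x s) - (x (s + i) - x s) := by abel
        rw [h3]
        refine ((hx1.sub (hx.mono hspace le_rfl)).sub (near_sum i hγ fun i hi =>
          (hp i hi).mono hspace le_rfl)).mono le_rfl ?_
        linarith
    · rcases Nat.lt_succ_iff_lt_or_eq.mp hi with h | rfl
      · exact (hq i h).trans hmono
      -- Both components are eliminated with the same coefficients, so the defect `q + A p`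
      -- undergoes the same elimination.
      · have h3 : q (s + i + 1) + A (p (s + i + 1)) =
            (residual g (x (s + i + 1)) - residual g (x (s + i)) +
              A (x (s + i + 1) - x (s + i))) -
            ∑ k ∈ Finset.range i, γ k • (q (s + k + 1) + A (p (s + k + 1))) := by
          rw [h1, h2]
          simp only [map_sub, map_sum, map_smul, smul_add, Finset.sum_add_distrib]
          abel
        rw [h3]
        have h4 := norm_sum_smul_le i hγ hq
        have h5 := hlin i (by omega) (i + 1) hj
        rw [← add_assoc] at h5
        refine (norm_sub_le _ _).trans ?_
        linarith

/-- The next residual is `(1 - A) r̄` up to a second-order error. -/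
lemma IsTameCycle.residual_next (hc : IsTameCycle g xs x p q s n τ H K) {A : E →L[ℝ] E}
    {D ε c : ℝ}
    (hlin : ∀ j ≤ n + 1, ‖residual g (x (s + j)) + A (x (s + j) - xs)‖ ≤ 2 * D ^ 2 * ε)
    (hq : ∀ i < n, ‖q (s + i + 1) + A (p (s + i + 1))‖ ≤ c) :
    ‖residual g (x (s + n + 1)) - (ContinuousLinearMap.id ℝ E - A)
      (sweep p q s n (x (s + n), residual g (x (s + n)))).2‖ ≤ 4 * D ^ 2 * ε + n * K * c := by
  obtain ⟨γ, hγ, h1, h2⟩ := hc.exists_sweep_eq le_rfl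
    (w := (x (s + n), residual g (x (s + n)))) (hc.norm_residual_le le_rfl)
  have h3 := hlin n (by omega)
  have h4 := hlin (n + 1) le_rfl
  rw [← add_assoc] at h4
  have h5 := norm_sum_smul_le n hγ hq
  have h6 : residual g (x (s + n + 1)) - (ContinuousLinearMap.id ℝ E - A)
      (sweep p q s n (x (s + n), residual g (x (s + n)))).2 =
      (residual g (x (s + n + 1)) + A (x (s + n + 1) - xs)) -
      (residual g (x (s + n)) + A (x (s + n) - xs)) +
      ∑ i ∈ Finset.range n, γ i • (q (s + i + 1) + A (p (s + i + 1))) := by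
    have h7 : A (x (s + n + 1)) = A (x (s + n)) -
        ∑ i ∈ Finset.range n, γ i • A (p (s + i + 1)) +
        A (sweep p q s n (x (s + n), residual g (x (s + n)))).2 := by
      rw [hc.iterate n le_rfl, h1]
      simp only [map_add, map_sub, map_sum, map_smul]
    simp only [sub_apply, ContinuousLinearMap.id_apply, map_sub, h7, smul_add,
      Finset.sum_add_distrib]
    have h8 : residual g (x (s + n)) = (sweep p q s n (x (s + n), residual g (x (s + n)))).2 +
        ∑ i ∈ Finset.range n, γ i • q (s + i + 1) := by rw [h2]; abel
    generalize (sweep p q s n (x (s + n), residual g (x (s + n)))).2 = b at *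
    rw [h8]
    abel
  rw [h6]
  refine (norm_add_le _ _).trans ?_
  have := norm_sub_le (residual g (x (s + n + 1)) + A (x (s + n + 1) - xs))
    (residual g (x (s + n)) + A (x (s + n) - xs))
  linarith

end Cycle

end RestartedAM

namespace RestartedAM

variable {E : Type*} [NormedAddCommGroup E] [InnerProductSpace ℝ E]

/-! ### Quantitative estimates for one cycle. -/

section CycleEstimates

variable {g : E → E} {xs : E} {ρ κ κh : ℝ} {x p q : ℕ → E} {s n : ℕ} {τ H : ℝ}

/-- The first step of a cycle is `x (s + 1) - x s = r`, so expansion by `1 - κ` bounds `q (s + 1)`;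
the restart test passes this on with factor `√τ`. The factor `3` keeps `x (s + 1)` in the ball, as
`‖r‖ ≤ 2 ‖x s - xs‖`. -/
lemma IsCycle.le_norm_pair (hc : IsCycle g x p q s n τ H) (hg : IsLocalContraction g xs ρ κ κh)
    (hκ : κ ≤ 1) (hτ : 0 ≤ τ) (hρ : 3 * ‖x s - xs‖ ≤ ρ) {i : ℕ} (hi : i < n) :
    √τ * (1 - κ) * ‖residual g (x s)‖ ≤ ‖q (s + i + 1)‖ := by
  have hR := norm_nonneg (x s - xs)
  have h1 : q (s + 1) = residual g (x (s + 1)) - residual g (x s) := by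
    simpa [sweep] using congrArg Prod.snd (hc.pair 0 (by omega))
  have h2 : x (s + 1) - x s = residual g (x s) := by rw [hc.iterate_zero]; abel
  have h3 := residual_upper hg hκ (by linarith) (x := x s) (by linarith)
  have h4 : ‖x (s + 1) - xs‖ ≤ ρ := by
    have := norm_add_le (x s - xs) (residual g (x s))
    rw [show x (s + 1) - xs = x s - xs + residual g (x s) by rw [hc.iterate_zero]; abel]
    linarith
  have h5 := residual_sub_lower hg (x := x s) (by linarith) h4
  rw [h2, ← h1] at h5
  have h6 : √τ * ‖q (s + 1)‖ ≤ ‖q (s + i + 1)‖ := by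
    refine le_of_sq_le_sq ?_ (norm_nonneg _)
    rw [mul_pow, Real.sq_sqrt hτ]
    exact hc.large i hi
  have := mul_le_mul_of_nonneg_left h5 (Real.sqrt_nonneg τ)
  linarith

/-- The smallness conditions under which a cycle started at distance `R` from the fixed point can
be analysed; `D` bounds the iterates and `c` the deviation from the linearized cycle. -/
structure SmallStart (ρ κ κh σ D c R : ℝ) (m : ℕ) : Prop where
  radius : D * R ≤ ρ
  deviation : 2 * (m * (c * (κh * R))) ≤ σ * (1 - κ)

/-- The constant in the one-cycle estimate. -/
noncomputable def cycleConst (κ σ K D c : ℝ) (m : ℕ) : ℝ :=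
  4 * D ^ 2 + m * K * c + κ * (4 * m * c / σ)

variable {m : ℕ} {K σ D c : ℝ}

lemma IsCycle.isTameCycle (hc : IsCycle g x p q s n τ H) (hg : IsLocalContraction g xs ρ κ κh)
    (hκ₁ : κ < 1) (hτ : 0 < τ) (hH : 1 ≤ H) (hσ : σ = √τ * (1 - κ)) (hK : K = 2 * H / σ)
    (hρ : 3 * ‖x s - xs‖ ≤ ρ) : IsTameCycle g xs x p q s n τ H K := by
  have hσ₀ : 0 < σ := hσ ▸ mul_pos (Real.sqrt_pos.mpr hτ) (by linarith)
  have hK₀ : 0 ≤ K := by rw [hK]; positivity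
  have hR := norm_nonneg (x s - xs)
  refine { hc with
    coeff := fun i hi => ?_
    start := residual_upper hg hκ₁.le (by linarith) (by linarith)
    nonneg_K := hK₀
    nonneg_H := by linarith }
  have h1 := mul_le_mul_of_nonneg_left (hc.le_norm_pair hg hκ₁.le hτ.le hρ hi) hK₀
  rw [← hσ] at h1
  have h2 : K * (σ * ‖residual g (x s)‖) = 2 * (H * ‖residual g (x s)‖) := by
    rw [hK]; field_simp
  linarith

/-- The estimates for one cycle. -/
lemma IsCycle.estimates (hc : IsCycle g x p q s n τ H) (hg : IsLocalContraction g xs ρ κ κh)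
    (hn : n ≤ m) (hκ₀ : 0 < κ) (hκ₁ : κ < 1) (hκh : 0 ≤ κh) (hτ : 0 < τ) (hH : 1 ≤ H)
    (hρ : 0 < ρ) (hσ : σ = √τ * (1 - κ)) (hK : K = 2 * H / σ) (hD : D = cycleBound K H (m + 1))
    (hcD : c = 3 * krylovBound K D m) (hsmall : SmallStart ρ κ κh σ D c ‖x s - xs‖ m) :
    ‖x (s + n + 1) - xs‖ ≤ ρ ∧
    (∀ w ∈ (krylov (ContinuousLinearMap.id ℝ E - fderiv ℝ g xs) (residual g (x s)) n).map
        (ContinuousLinearMap.id ℝ E - fderiv ℝ g xs).toLinearMap,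
      ‖residual g (x s) + w‖ ≤ ‖residual g (x s)‖ →
      ‖residual g (x (s + n + 1))‖ ≤ κ * ‖residual g (x s) + w‖ +
        κh * (cycleConst κ σ K D c m * ‖x s - xs‖ ^ 2)) ∧
    (∀ [FiniteDimensional ℝ E], n = Module.finrank ℝ E →
      ‖residual g (x (s + n + 1))‖ ≤ κh * (cycleConst κ σ K D c m * ‖x s - xs‖ ^ 2)) := by
  have hσ₀ : 0 < σ := hσ ▸ mul_pos (Real.sqrt_pos.mpr hτ) (by linarith)
  have hK₀ : 0 ≤ K := by rw [hK]; positivity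
  have hH₀ : 0 ≤ H := by linarith
  set R := ‖x s - xs‖ with hRdef
  have hR : 0 ≤ R := norm_nonneg _
  have hD4 : 4 ≤ D := by
    have := cycleBound_mono hK₀ hH₀ (show 1 ≤ m + 1 by omega)
    rw [← hD] at this
    simp only [cycleBound] at this
    push_cast at this
    linarith
  have hc₀ : 0 ≤ c := by
    rw [hcD]; exact mul_nonneg zero_le_three (krylovBound_nonneg D hK₀ m)
  have hDR := hsmall.radius
  have h3R : 3 * R ≤ ρ := (mul_le_mul_of_nonneg_right (by linarith) hR).trans hDR
  have ht := hc.isTameCycle hg hκ₁ hτ hH hσ hK h3R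
  set A := ContinuousLinearMap.id ℝ E - fderiv ℝ g xs with hAdef
  set ε := κh * R ^ 2 with hεdef
  have hε : 0 ≤ ε := by positivity
  have hG : ‖fderiv ℝ g xs‖ ≤ κ := norm_fderiv_le hg hκ₀.le hρ
  have hA : ‖A‖ ≤ 2 := by
    have := norm_sub_le (ContinuousLinearMap.id ℝ E) (fderiv ℝ g xs)
    have := ContinuousLinearMap.norm_id_le (𝕜 := ℝ) (E := E)
    linarith
  have hbound : ∀ j ≤ n + 1, ‖x (s + j) - xs‖ ≤ D * R := by
    intro j hj
    obtain ⟨hx, hp⟩ := ht.bounds le_rfl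
    have hmono : cycleBound K H n * R ≤ cycleBound K H (n + 1) * R :=
      mul_le_mul_of_nonneg_right (cycleBound_mono hK₀ hH₀ n.le_succ) hR
    have hmono' : cycleBound K H (n + 1) * R ≤ D * R :=
      mul_le_mul_of_nonneg_right (hD ▸ cycleBound_mono hK₀ hH₀ (by omega)) hR
    rcases Nat.le_succ_iff.mp hj with h | rfl
    · exact (hx j h).trans (hmono.trans hmono')
    · refine le_trans ?_ hmono'
      have h1 := ht.norm_iterate_sub_le le_rfl (hx n le_rfl) hp
      have h2 : cycleBound K H (n + 1) * R = 2 * (cycleBound K H n * R) +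
          2 * (n * K * (cycleBound K H n * R)) + 2 * H * R := by
        rw [cycleBound]; ring
      have h3 : 0 ≤ cycleBound K H n * R :=
        mul_nonneg (zero_le_one.trans (cycleBound_pos hK₀ hH₀ n)) hR
      have h4 : 0 ≤ n * K * (cycleBound K H n * R) := by positivity
      rw [Nat.succ_eq_add_one, ← add_assoc]
      linarith
  have hDR₀ : 0 ≤ D * R := by positivity
  have hε' : 2 * (D * R) ^ 2 * κh = 2 * D ^ 2 * ε := by rw [hεdef]; ring
  have hlin : ∀ i ≤ n, ∀ j ≤ n, ‖residual g (x (s + j)) - residual g (x (s + i)) +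
      A (x (s + j) - x (s + i))‖ ≤ 2 * D ^ 2 * ε := fun i hi j hj => by
    rw [← hε']
    exact residual_linearization hg hκh hDR₀ hDR (hbound i (by omega)) (hbound j (by omega))
  have hlin' : ∀ j ≤ n + 1, ‖residual g (x (s + j)) + A (x (s + j) - xs)‖ ≤ 2 * D ^ 2 * ε :=
    fun j hj => by
      have := residual_linearization hg hκh hDR₀ hDR (x := xs) (by simpa using hDR₀)
        (hbound j hj)
      rwa [residual_fixed hg, sub_zero, hε'] at this
  obtain ⟨-, hpK, hqA⟩ := ht.near_krylov hA hε hlin le_rfl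
  have hcn : 3 * (krylovBound K D n * ε) ≤ c * ε := by
    rw [hcD, mul_assoc]
    exact mul_le_mul_of_nonneg_left
      (mul_le_mul_of_nonneg_right (krylovBound_mono D hK₀ hn) hε) zero_le_three
  have hcn₀ : 0 ≤ krylovBound K D n * ε := mul_nonneg (krylovBound_nonneg D hK₀ n) hε
  have hnm : (n : ℝ) ≤ m := by exact_mod_cast hn
  have hqA' : ∀ i < n, ‖q (s + i + 1) + A (p (s + i + 1))‖ ≤ c * ε := fun i hi =>
    (hqA i hi).trans (by linarith)
  have hnext := ht.residual_next hlin' hqA'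
  set rb := (sweep p q s n (x (s + n), residual g (x (s + n)))).2 with hrb
  have hstep : ‖residual g (x (s + n + 1))‖ ≤ κ * ‖rb‖ + (4 * D ^ 2 * ε + m * K * (c * ε)) := by
    have h1 : ‖(ContinuousLinearMap.id ℝ E - A) rb‖ ≤ κ * ‖rb‖ := by
      rw [hAdef, sub_sub_cancel]
      exact (ContinuousLinearMap.le_opNorm _ _).trans
        (mul_le_mul_of_nonneg_right hG (norm_nonneg _))
    have h2 := norm_add_le (residual g (x (s + n + 1)) - (ContinuousLinearMap.id ℝ E - A) rb)
      ((ContinuousLinearMap.id ℝ E - A) rb)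
    rw [sub_add_cancel] at h2
    have h3 : n * K * (c * ε) ≤ m * K * (c * ε) := by gcongr
    linarith
  have hextra : 0 ≤ κ * (4 * m * c / σ) * ε := by positivity
  have hconst : κh * (cycleConst κ σ K D c m * R ^ 2) =
      4 * D ^ 2 * ε + m * K * (c * ε) + κ * (4 * m * c / σ) * ε := by
    rw [cycleConst, hεdef]; ring
  have hrb0 : rb = 0 → ‖residual g (x (s + n + 1))‖ ≤
      κh * (cycleConst κ σ K D c m * R ^ 2) := fun h => by
    rw [h, norm_zero, mul_zero, zero_add] at hstep
    linarith
  have hzero : residual g (x s) = 0 → rb = 0 := fun h => by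
    have h1 := (norm_sweep_snd_le p q s n (x (s + n), residual g (x (s + n)))).trans
      (hc.growth n le_rfl)
    rw [h, norm_zero, mul_zero] at h1
    exact norm_le_zero_iff.mp h1
  have hlow : ∀ i < n, σ * ‖residual g (x s)‖ ≤ ‖q (s + i + 1)‖ := fun i hi =>
    hσ ▸ hc.le_norm_pair hg hκ₁.le hτ.le h3R hi
  have horth : ∀ i j : Fin n, i ≠ j → inner ℝ (q (s + i + 1)) (q (s + j + 1)) = (0 : ℝ) :=
    fun i j hij => hc.inner_eq_zero i i.2 j j.2 fun h => hij (Fin.ext h)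
  refine ⟨(hbound (n + 1) le_rfl).trans hDR, fun w hw hwr => ?_, fun hdim => ?_⟩
  · rcases eq_or_ne (residual g (x s)) 0 with h0 | h0
    · have := hrb0 (hzero h0)
      have : 0 ≤ κ * ‖residual g (x s) + w‖ := by positivity
      linarith
    have hr : 0 < ‖residual g (x s)‖ := norm_pos_iff.mpr h0
    have hrR := residual_lower hg hρ.le (x := x s) (by linarith)
    -- The `3` in `c` is one error for `q + A p` and two for `A` applied to the error of `p`.
    have hqV : ∀ i : Fin n, Near ((krylov A (residual g (x s)) n).map A.toLinearMap)
        (c * ε) (q (s + i + 1)) := by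
      intro i
      obtain ⟨u, hu, hpu⟩ := hpK i i.2
      refine ⟨-A u, neg_mem ⟨u, hu, rfl⟩, le_trans ?_ hcn⟩
      have h1 : q (s + i + 1) - -A u =
          (q (s + i + 1) + A (p (s + i + 1))) - A (p (s + i + 1) - u) := by
        rw [map_sub]; abel
      have h2 : ‖A (p (s + i + 1) - u)‖ ≤ 2 * (krylovBound K D n * ε) :=
        (A.le_opNorm _).trans (mul_le_mul hA hpu (norm_nonneg _) zero_le_two)
      rw [h1]
      have := norm_sub_le (q (s + i + 1) + A (p (s + i + 1))) (A (p (s + i + 1) - u))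
      linarith [hqA i i.2]
    have hcε : 0 ≤ c * ε := by positivity
    have hdev : 2 * (n * (c * ε)) ≤ σ * ‖residual g (x s)‖ := by
      calc 2 * (n * (c * ε)) ≤ 2 * (m * (c * ε)) := by gcongr
        _ = 2 * (m * (c * (κh * R))) * R := by rw [hεdef]; ring
        _ ≤ σ * (1 - κ) * R := mul_le_mul_of_nonneg_right hsmall.deviation hR
        _ = σ * ((1 - κ) * R) := by ring
        _ ≤ _ := mul_le_mul_of_nonneg_left hrR hσ₀.le
    obtain ⟨a, ha⟩ := exists_combination_near (finrank_map_krylov_le A (residual g (x s)) n)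
      horth (mul_pos hσ₀ hr) (fun i => hlow i i.2) hqV hdev hw
    have hw2 : ‖w‖ ≤ 2 * ‖residual g (x s)‖ := by
      have := norm_sub_le (residual g (x s) + w) (residual g (x s))
      rw [add_sub_cancel_left] at this
      linarith
    -- As `‖w‖ ≤ 2 ‖r‖` and the `q i` have size at least `σ ‖r‖`, the factor `‖r‖` cancels and the
    -- error stays of order `κh R²`.
    have herr : c * ε * (2 * n * ‖w‖ / (σ * ‖residual g (x s)‖)) ≤ 4 * m * c / σ * ε := by
      calc c * ε * (2 * n * ‖w‖ / (σ * ‖residual g (x s)‖))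
          ≤ c * ε * (2 * m * (2 * ‖residual g (x s)‖) / (σ * ‖residual g (x s)‖)) := by gcongr
        _ = _ := by field_simp; ring
    have hrbw : ‖rb‖ ≤ ‖residual g (x s) + w‖ + 4 * m * c / σ * ε := by
      have h1 := hc.norm_sweep_le a
      have h2 := norm_add_le (residual g (x s) + w) (∑ i, a i • q (s + i + 1) - w)
      rw [add_assoc, add_sub_cancel] at h2
      linarith
    have := mul_le_mul_of_nonneg_left hrbw hκ₀.le
    linarith
  · rcases eq_or_ne (residual g (x s)) 0 with h0 | h0
    · exact hrb0 (hzero h0)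
    apply hrb0
    have hr : 0 < ‖residual g (x s)‖ := norm_pos_iff.mpr h0
    have hne : ∀ i : Fin n, q (s + i + 1) ≠ 0 := fun i =>
      norm_pos_iff.mp ((mul_pos hσ₀ hr).trans_le (hlow i i.2))
    have hli : LinearIndependent ℝ fun i : Fin n => q (s + i + 1) :=
      linearIndependent_of_ne_zero_of_inner_eq_zero hne fun i j hij => horth i j hij
    have hspan := hli.span_eq_top_of_card_eq_finrank' (by simpa using hdim)
    obtain ⟨a, ha⟩ := (Submodule.mem_span_range_iff_exists_fun ℝ).mp
      (hspan ▸ Submodule.mem_top : -residual g (x s) ∈ _)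
    have h1 := hc.norm_sweep_le a
    rw [ha, add_neg_cancel, norm_zero] at h1
    exact norm_le_zero_iff.mp h1

end CycleEstimates

end RestartedAM

/-! ### Propagation from cycle to cycle. -/

namespace RestartedAM

variable {E : Type*} [NormedAddCommGroup E] [InnerProductSpace ℝ E]

/-- If every cycle does not increase the norm of the residual, then all cycles start in the ball in
which the first one does. -/
lemma IsRun.start_le {g : E → E} {m : ℕ} {τ η ρ κ κh b : ℝ} {xs : E}
    {x p q : ℕ → E} {M : ℕ → ℕ} (h : IsRun g (fun _ => 1) m τ η x p q M)
    (hg : IsLocalContraction g xs ρ κ κh) (hκ₀ : 0 < κ) (hκ₁ : κ < 1) (hb : 0 ≤ b) (hbρ : b ≤ ρ)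
    (hx : ‖x 0 - xs‖ ≤ b * (1 - κ) / 2)
    (hstep : ∀ k, ‖x (k - M k) - xs‖ ≤ b → ‖x (k + 1) - xs‖ ≤ ρ ∧
      ‖residual g (x (k + 1))‖ ≤ ‖residual g (x (k - M k))‖) (k : ℕ) :
    ‖x (k - M k) - xs‖ ≤ b := by
  -- The residual bound is the quantity that propagates; dividing it by `1 - κ` recovers the
  -- distance `b`.
  suffices key : ‖x (k - M k) - xs‖ ≤ b ∧ ‖residual g (x (k - M k))‖ ≤ (1 - κ) * b from key.1
  induction k with
  | zero =>
    have h1 : ‖x 0 - xs‖ ≤ b := by nlinarith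
    rw [Nat.zero_sub]
    refine ⟨h1, (residual_upper hg hκ₁.le (hb.trans hbρ) (h1.trans hbρ)).trans ?_⟩
    linarith
  | succ k ih =>
    rcases Nat.eq_zero_or_pos (M (k + 1)) with h0 | h0
    · obtain ⟨h1, h2⟩ := hstep k ih.1
      have h3 := residual_lower hg (hb.trans hbρ) h1
      rw [h0, Nat.sub_zero]
      have h4 := h2.trans ih.2
      exact ⟨le_of_mul_le_mul_left (h3.trans h4) (by linarith), h4⟩
    · rwa [h.memory_succ h0, Nat.add_sub_add_right]

end RestartedAM

/-! ### Choice of constants and conclusion. -/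

open RestartedAM in
theorem corollary4p1 (d m : ℕ) (κ τ η : ℝ)
    (hκ₀ : 0 < κ) (hκ₁ : κ < 1) (hm : 0 < m) (hτ₀ : 0 < τ) (hτ₁ : τ < 1) (hη : 0 < η) :
    ∃ C : ℝ, 0 < C ∧ ∀ ρ κh : ℝ, 0 < ρ → 0 < κh →
      ∃ δ : ℝ, 0 < δ ∧
        ∀ (g : EuclideanSpace ℝ (Fin d) → EuclideanSpace ℝ (Fin d))
          (xs : EuclideanSpace ℝ (Fin d)), IsLocalContraction g xs ρ κ κh →
        ∀ (x p q : ℕ → EuclideanSpace ℝ (Fin d)) (M : ℕ → ℕ),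
          RestartedAM.IsRun g (fun _ => 1) m τ η x p q M → ‖x 0 - xs‖ ≤ δ →
        ∀ k : ℕ,
          (∃ μ : ℝ,
            IsLeast (RestartedAM.polyNorms
              (ContinuousLinearMap.id ℝ (EuclideanSpace ℝ (Fin d)) - fderiv ℝ g xs)
              (M k) (RestartedAM.residual g (x (k - M k)))) μ ∧
            ‖RestartedAM.residual g (x (k + 1))‖ ≤
              κ * μ + κh * (C * ‖x (k - M k) - xs‖ ^ 2)) ∧
          (M k = d → ‖x (k + 1) - xs‖ ≤ κh * (C * ‖x (k - M k) - xs‖ ^ 2)) := by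
  have hκ : 0 < 1 - κ := sub_pos.mpr hκ₁
  have hH : (1 : ℝ) ≤ max 1 η := le_max_left _ _
  obtain ⟨H, hHdef⟩ : ∃ H, H = max 1 η := ⟨_, rfl⟩
  obtain ⟨σ, hσ⟩ : ∃ σ, σ = √τ * (1 - κ) := ⟨_, rfl⟩
  obtain ⟨K, hK⟩ : ∃ K, K = 2 * H / σ := ⟨_, rfl⟩
  obtain ⟨D, hD⟩ : ∃ D, D = cycleBound K H (m + 1) := ⟨_, rfl⟩
  obtain ⟨c, hc⟩ : ∃ c, c = 3 * krylovBound K D m := ⟨_, rfl⟩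
  rw [← hHdef] at hH
  have hσ₀ : 0 < σ := hσ ▸ mul_pos (Real.sqrt_pos.mpr hτ₀) hκ
  have hK₀ : 0 ≤ K := by rw [hK]; positivity
  have hD₁ : 1 ≤ D := hD ▸ cycleBound_pos hK₀ (by linarith) _
  have hc₀ : 0 ≤ c := by
    rw [hc]; exact mul_nonneg zero_le_three (krylovBound_nonneg D hK₀ m)
  obtain ⟨B, hB⟩ : ∃ B, B = cycleConst κ σ K D c m := ⟨_, rfl⟩
  have hB₀ : 0 < B := by rw [hB, cycleConst]; positivity
  -- `B` suits the residual estimate; dividing by `1 - κ` converts residuals to distances.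
  refine ⟨B / (1 - κ), by positivity, fun ρ κh hρ hκh => ?_⟩
  -- The three terms keep the cycle in the ball, make the `q i` accurate enough for
  -- `exists_combination_near`, and prevent residual growth. The `+ 1` keeps the denominator
  -- positive.
  obtain ⟨b, hb⟩ : ∃ b, b = min (ρ / D) (min (σ * (1 - κ) / (2 * (m * (c * κh)) + 1))
    ((1 - κ) ^ 2 / (κh * B))) := ⟨_, rfl⟩
  have hb₀ : 0 < b := by
    rw [hb]; refine lt_min ?_ (lt_min ?_ ?_) <;> positivity
  have hbD : b * D ≤ ρ := by
    rw [← le_div_iff₀ (by linarith)]; exact hb ▸ min_le_left _ _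
  have hbσ : b * (2 * (m * (c * κh)) + 1) ≤ σ * (1 - κ) := by
    rw [← le_div_iff₀ (by positivity)]
    exact hb ▸ (min_le_right _ _).trans (min_le_left _ _)
  have hbB : b * (κh * B) ≤ (1 - κ) ^ 2 := by
    rw [← le_div_iff₀ (by positivity)]
    exact hb ▸ (min_le_right _ _).trans (min_le_right _ _)
  have hbρ : b ≤ ρ := by nlinarith
  refine ⟨b * (1 - κ) / 2, by positivity, fun g xs hg x p q M hrun hx => ?_⟩
  have est := fun k (hR : ‖x (k - M k) - xs‖ ≤ b) =>
    (hHdef ▸ hrun.isCycle k).estimates hg (hrun.memory_le k) hκ₀ hκ₁ hκh.le hτ₀ hH hρ hσ hK hD hc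
      ⟨by nlinarith [norm_nonneg (x (k - M k) - xs)], by
        have h1 : 0 ≤ 2 * (m * (c * κh)) := by positivity
        have h2 := mul_le_mul_of_nonneg_left hR h1
        nlinarith⟩
  have hind : ∀ k, k - M k + M k = k := fun k => Nat.sub_add_cancel (hrun.memory_le_index k)
  simp only [hind, ← hB] at est
  have hstart : ∀ k, ‖x (k - M k) - xs‖ ≤ b := by
    refine hrun.start_le hg hκ₀ hκ₁ hb₀.le hbρ hx fun k hk => ?_
    obtain ⟨h1, h2, -⟩ := est k hk
    refine ⟨h1, ?_⟩
    -- The polynomial `1` gives `κ ‖r‖` plus an error that the choice of `b` bounds by `(1 - κ)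
    -- ‖r‖`.
    have h3 := h2 0 (Submodule.zero_mem _) (by rw [add_zero])
    rw [add_zero] at h3
    have h4 := residual_lower hg hρ.le (hk.trans hbρ)
    set R := ‖x (k - M k) - xs‖
    have hR : 0 ≤ R := norm_nonneg _
    have h5 : κh * (B * R ^ 2) ≤ (1 - κ) * ((1 - κ) * R) := by
      calc κh * (B * R ^ 2) = R * (κh * B) * R := by ring
        _ ≤ b * (κh * B) * R := by gcongr
        _ ≤ (1 - κ) ^ 2 * R := by gcongr
        _ = _ := by ring
    have h6 := mul_le_mul_of_nonneg_left h4 hκ.le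
    linarith
  intro k
  obtain ⟨h1, h2, h3⟩ := est k (hstart k)
  have hle : B ≤ B / (1 - κ) := by
    rw [le_div_iff₀ hκ]; nlinarith
  constructor
  · obtain ⟨w, hw, hleast⟩ := exists_isLeast_polyNorms
      (ContinuousLinearMap.id ℝ (EuclideanSpace ℝ (Fin d)) - fderiv ℝ g xs)
      (M k) (residual g (x (k - M k)))
    refine ⟨_, hleast, (h2 w hw (hleast.2 ⟨1, by simp, by simp, by simp⟩)).trans ?_⟩
    gcongr
  · intro hd
    have h4 := residual_lower hg hρ.le h1
    have h5 := h3 (by simpa using hd)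
    have h6 : κh * (B / (1 - κ) * ‖x (k - M k) - xs‖ ^ 2) =
        κh * (B * ‖x (k - M k) - xs‖ ^ 2) / (1 - κ) := by ring
    rw [h6, le_div_iff₀ hκ]
    linarith
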